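/- Consider a player of the Colonel Blotto game who distributes $N\ge 0$ troops over $K$ battlefields. His layered graph has vertices $v_{k,i}$ ($0\le k\le K$, $0\le i\le N$) and a directed edge from $v_{k,i}$ to $v_{k+1,j}$ for all $0\le k<K$ and $0\le i\le j\le N$. His \emph{membership polytope} $P_{K,N}$ is the set of all unit flows from $v_{0,0}$ to $v_{K,N}$ in this graph, i.e. of all real vectors $F=(F_{k,i,j})$ indexed by the edges such that \begin{itemize} \item $F_{k,i,j}\ge 0$ for every edge; \item for $1\le k\le K-1$ and $0\le l\le N$, the flow entering $v_{k,l}$ equals the flow leaving $v_{k,l}$; \item the flow leaving $v_{0,0}$ is $1$, and the flow leaving $v_{0,l}$ is $0$ for $0<l\le N$; \item the flow entering $v_{K,N}$ is $1$. \end{itemize} A pure strategy is a vector $s=(s_1,\dots,s_K)$ of nonnegative integers with $s_1+\dots+s_K=N$; its canonical path visits $v_{k,\,s_1+\dots+s_k}$ for $k=0,\dots,K$. A mixed strategy $x$ (a probability distribution on the pure strategies) induces the flow whose value on an edge $e$ is the total probability $\sum_{s\,:\,e\in \mathrm{path}(s)}x(s)$. The extension complexity $\mathrm{xc}(P)$ of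 a polytope $P$ is the smallest number of facets of a polytope $Q\subseteq\mathbb R^m$, $m$ arbitrary, such that $\pi(Q)=P$ for some linear map $\pi$. Then there is an absolute constant $c>0$ such that for all $K\ge 3$ and all $N\ge 0$: the membership polytope $P_{K,N}$ is exactly the set of flows induced by the mixed strategies of the player, and $$\mathrm{xc}(P_{K,N})\ \ge\ c\,N^2K .$$ -/

import Mathlib

/-! ### Polytopes, facets, extension complexity -/

/-- A polytope: the convex hull of finitely many points. -/
def IsPolytope {E : Type*} [AddCommGroup E] [Module ℝ E] (Q : Set E) : Prop :=
  ∃ V : Finset E, Q = convexHull ℝ (V : Set E)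

/-- The dimension of (the affine hull of) a nonempty set. -/
noncomputable def affDim {E : Type*} [AddCommGroup E] [Module ℝ E] (S : Set E) : ℕ :=
  Module.finrank ℝ (affineSpan ℝ S).direction

/-- `F` is a facet of `Q`: a nonempty face of `Q`, cut out by a supporting hyperplane, whose
dimension is one less than that of `Q`. -/
def IsFacet {E : Type*} [AddCommGroup E] [Module ℝ E] [TopologicalSpace E] (Q F : Set E) : Prop :=
  F.Nonempty ∧ IsExposed ℝ Q F ∧ affDim F + 1 = affDim Q

/-- `P` is the image under a linear map of a polytope `Q` (in some `ℝ ^ m`) that has exactly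
`r` facets. -/
def HasExtensionOfSize {E : Type*} [AddCommGroup E] [Module ℝ E] (P : Set E) (r : ℕ) : Prop :=
  ∃ (m : ℕ) (Q : Set (Fin m → ℝ)) (π : (Fin m → ℝ) →ₗ[ℝ] E),
    IsPolytope Q ∧ π '' Q = P ∧ {F | IsFacet Q F}.encard = r

/-- The extension complexity of a polytope `P`: the smallest number of facets of a polytope
that has `P` as a linear image. -/
noncomputable def extensionComplexity {E : Type*} [AddCommGroup E] [Module ℝ E]
    (P : Set E) : ℕ :=
  sInf {r | HasExtensionOfSize P r}

namespace Blotto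

/-! ### The layered graph and its unit flows -/

/-- The layered graph with `K` battlefields and `N` troops has vertices `v_{k,i}` for
`0 ≤ k ≤ K`, `0 ≤ i ≤ N`. An element `(k, i, j)` of `Edge K N` is the directed edge from `v_{k,i}`
to `v_{k+1,j}`, where `0 ≤ k < K` and `0 ≤ i ≤ j ≤ N`. -/
abbrev Edge (K N : ℕ) : Type :=
  {e : Fin K × Fin (N + 1) × Fin (N + 1) // e.2.1 ≤ e.2.2}

/-- The layer `k` in which the edge `(k, i, j)` starts. -/
abbrev Edge.layer {K N : ℕ} (e : Edge K N) : ℕ := (e.1.1 : ℕ)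

/-- The index `i` of the vertex `v_{k,i}` in which the edge `(k, i, j)` starts. -/
abbrev Edge.tail {K N : ℕ} (e : Edge K N) : ℕ := (e.1.2.1 : ℕ)

/-- The index `j` of the vertex `v_{k+1,j}` in which the edge `(k, i, j)` ends. -/
abbrev Edge.head {K N : ℕ} (e : Edge K N) : ℕ := (e.1.2.2 : ℕ)

/-- The amount of flow that leaves the vertex `v_{k,l}`. -/
noncomputable def outflow {K N : ℕ} (F : Edge K N → ℝ) (k l : ℕ) : ℝ :=
  ∑ e : Edge K N with e.layer = k ∧ e.tail = l, F e

/-- The amount of flow that enters the vertex `v_{k,l}`. -/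
noncomputable def inflow {K N : ℕ} (F : Edge K N → ℝ) (k l : ℕ) : ℝ :=
  ∑ e : Edge K N with e.layer + 1 = k ∧ e.head = l, F e

/-- The membership constraints: `F` is a flow of size `1` from `v_{0,0}` to `v_{K,N}`. -/
structure IsUnitFlow {K N : ℕ} (F : Edge K N → ℝ) : Prop where
  nonneg : ∀ e, 0 ≤ F e
  conservation : ∀ k l, 1 ≤ k → k + 1 ≤ K → l ≤ N → inflow F k l = outflow F k l
  source : outflow F 0 0 = 1
  no_other_source : ∀ l, 0 < l → l ≤ N → outflow F 0 l = 0
  sink : inflow F K N = 1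

/-- The membership polytope of a player with `N` troops and `K` battlefields: all vectors that
satisfy the membership constraints. -/
def membershipPolytope (K N : ℕ) : Set (Edge K N → ℝ) :=
  {F | IsUnitFlow F}

/-! ### Strategies and the flows they induce -/

/-- A pure strategy: an allocation of the `N` troops to the `K` battlefields. -/
abbrev PureStrategy (K N : ℕ) : Type :=
  {s : Fin K → Fin (N + 1) // ∑ i, (s i : ℕ) = N}

/-- The number of troops that `s` puts in the first `k` battlefields. -/
def PureStrategy.prefixSum {K N : ℕ} (s : PureStrategy K N) (k : ℕ) : ℕ :=
  ∑ i : Fin K with i.val < k, (s.1 i : ℕ)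

/-- The canonical path `v_{0,0}, …, v_{K,N}` of the pure strategy `s`, whose vertex in layer `k` is
`v_{k, s.prefixSum k}`, contains the edge `e`. -/
abbrev PureStrategy.Uses {K N : ℕ} (s : PureStrategy K N) (e : Edge K N) : Prop :=
  s.prefixSum e.layer = e.tail ∧ s.prefixSum (e.layer + 1) = e.head

/-- The flow in the layered graph that a mixed strategy `x` corresponds to: each pure strategy `s`
sends flow `x s` along its canonical path. -/
noncomputable def flowOfMixed {K N : ℕ} (x : PureStrategy K N → ℝ) (e : Edge K N) : ℝ :=
  ∑ s : PureStrategy K N with s.Uses e, x s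

end Blotto

/-! The lower bound is a dimension bound. A linear map does not raise dimension, and a polytope of
dimension `d` has at least `d` facets, so the extension complexity is at least the dimension of the
membership polytope, which is at least `(K - 2) * N * (N + 1) / 2`.

Facets are counted by polarity. For `Q = conv V` with `x₀` the centroid of `V`, record a functional
`φ` by its values at the vectors `v - x₀`. These records form a subspace `L` of `V → ℝ` with
dimension that of `Q`, and those with entries at most `1` form the polar of `Q - x₀`, a compact
convex set. Its extreme points span `L` (`le_span_extremePoints_polarBody`), and distinct ones
define distinct facets (`isFacet_levelFace`, `evalSub_eq_of_levelFace_eq`).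

For the description by mixed strategies, an extreme unit flow must be the flow along a path in its
support, since part of that path can be split off; Krein-Milman then applies. For the dimension,
each edge between inner layers with head below `N` gets a path for which it is the last such edge,
and triangularity gives linear independence (`card_innerEdge_le_affDim`). -/

/-- The elements of a subspace of `ι → ℝ` whose coordinates are all at most `1`. -/
def polarBody {ι : Type*} (L : Submodule ℝ (ι → ℝ)) : Set (ι → ℝ) :=
  {a | a ∈ L ∧ ∀ i, a i ≤ 1}

/-! ### Extreme points of the polar body. -/

section PolarBody

variable {ι : Type*} {L : Submodule ℝ (ι → ℝ)}

theorem convex_polarBody : Convex ℝ (polarBody L) := by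
  rintro a ⟨ha, ha'⟩ b ⟨hb, hb'⟩ s t hs ht hst
  refine ⟨L.add_mem (L.smul_mem _ ha) (L.smul_mem _ hb), fun i => ?_⟩
  have h1 := mul_le_mul_of_nonneg_left (ha' i) hs
  have h2 := mul_le_mul_of_nonneg_left (hb' i) ht
  simp only [Pi.add_apply, Pi.smul_apply, smul_eq_mul]
  linarith

variable [Fintype ι]

/-- Since the coordinates sum to zero, the upper bound `1` on all of them also bounds each one from
below. -/
theorem isCompact_polarBody (hL : ∀ a ∈ L, ∑ i, a i = 0) : IsCompact (polarBody L) := by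
  have hclosed : IsClosed (polarBody L) := by
    exact (Submodule.closed_of_finiteDimensional L).inter (isClosed_Iic (a := fun _ : ι => (1 : ℝ)))
  refine (isCompact_univ_pi fun _ : ι =>
    isCompact_Icc (a := -(Fintype.card ι : ℝ)) (b := 1)).of_isClosed_subset hclosed ?_
  rintro a ⟨ha, ha'⟩ i -
  refine ⟨?_, ha' i⟩
  classical
  have h1 := hL a ha
  rw [← Finset.add_sum_erase _ _ (Finset.mem_univ i)] at h1
  have h2 : ∑ j ∈ Finset.univ.erase i, a j ≤ ∑ j ∈ Finset.univ.erase i, (1 : ℝ) :=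
    Finset.sum_le_sum fun j _ => ha' j
  have h3 : ∑ j ∈ Finset.univ.erase i, (1 : ℝ) ≤ ∑ j : ι, (1 : ℝ) :=
    Finset.sum_le_sum_of_subset_of_nonneg (Finset.erase_subset _ _) fun _ _ _ => zero_le_one
  simp only [Finset.sum_const, Finset.card_univ, nsmul_eq_mul, mul_one] at h3
  simp only [Finset.sum_const, nsmul_eq_mul, mul_one] at h2
  linarith

theorem exists_pos_forall_mul_abs_le (b δ : ι → ℝ) (hδ : ∀ i, 0 < δ i) :
    ∃ ε : ℝ, 0 < ε ∧ ∀ i, ε * |b i| ≤ δ i := by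
  rcases isEmpty_or_nonempty ι with h | h
  · exact ⟨1, one_pos, fun i => isEmptyElim i⟩
  · obtain ⟨i, hi⟩ := Finite.exists_min fun i => δ i / (|b i| + 1)
    refine ⟨δ i / (|b i| + 1), div_pos (hδ i) (by positivity), fun j => ?_⟩
    have hj := hi j
    rw [le_div_iff₀ (by positivity)] at hj
    have : 0 < δ i / (|b i| + 1) := div_pos (hδ i) (by positivity)
    nlinarith

/-- A small multiple of any element of `L` lies in the body, which by Krein-Milman is the closed
convex hull of its extreme points; their span is closed. -/
theorem le_span_extremePoints_polarBody (hL : ∀ a ∈ L, ∑ i, a i = 0) :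
    L ≤ Submodule.span ℝ (Set.extremePoints ℝ (polarBody L)) := by
  intro a ha
  obtain ⟨ε, hε, h⟩ := exists_pos_forall_mul_abs_le a 1 fun _ => one_pos
  have hmem : ε • a ∈ polarBody L :=
    ⟨L.smul_mem _ ha, fun i =>
      (mul_le_mul_of_nonneg_left (le_abs_self (a i)) hε.le).trans (h i)⟩
  rw [← closure_convexHull_extremePoints (isCompact_polarBody hL) convex_polarBody] at hmem
  have hsub : closure (convexHull ℝ (Set.extremePoints ℝ (polarBody L))) ⊆
      Submodule.span ℝ (Set.extremePoints ℝ (polarBody L)) :=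
    closure_minimal (convexHull_min Submodule.subset_span (Submodule.convex _))
      (Submodule.closed_of_finiteDimensional _)
  exact (Submodule.smul_mem_iff _ hε.ne').1 (hsub hmem)

/-- A direction `b` that vanishes at the tight coordinates allows a small move both ways from `a`
inside the body, which extremality forbids unless `b = 0`. -/
theorem eq_zero_of_mem_extremePoints_polarBody {a b : ι → ℝ}
    (ha : a ∈ Set.extremePoints ℝ (polarBody L)) (hb : b ∈ L)
    (hab : ∀ i, a i = 1 → b i = 0) : b = 0 := by
  classical
  obtain ⟨ε, hε, h⟩ := exists_pos_forall_mul_abs_le b (fun i => if a i = 1 then 1 else 1 - a i)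
    fun i => by
      split_ifs with h
      · exact one_pos
      · exact sub_pos.2 (lt_of_le_of_ne (ha.1.2 i) h)
  have hmem : ∀ s : ℝ, |s| = ε → a + s • b ∈ polarBody L := fun s hs => by
    refine ⟨L.add_mem ha.1.1 (L.smul_mem _ hb), fun i => ?_⟩
    by_cases hi : a i = 1
    · simp [hi, hab i hi]
    · have := h i
      rw [if_neg hi, ← hs, ← abs_mul] at this
      have := le_abs_self (s * b i)
      simp only [Pi.add_apply, Pi.smul_apply, smul_eq_mul]
      linarith
  have heq := ha.2 (hmem ε (abs_of_pos hε)) (hmem (-ε) (by rw [abs_neg, abs_of_pos hε]))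
    ⟨1 / 2, 1 / 2, by norm_num, by norm_num, by norm_num, by ext i; simp; ring⟩
  have : ε • b = 0 := by simpa using heq
  exact (smul_eq_zero.1 this).resolve_left hε.ne'

end PolarBody

/-! ### Facets, dimension and extension complexity. -/

section Polytope

variable {E : Type*} [NormedAddCommGroup E] [NormedSpace ℝ E]

theorem convexHull_subset_halfspace {V : Set E} (φ : Module.Dual ℝ E) {r : ℝ}
    (h : ∀ v ∈ V, φ v ≤ r) {x : E} (hx : x ∈ convexHull ℝ V) : φ x ≤ r :=
  convexHull_min (t := {y | φ y ≤ r}) h (convex_halfSpace_le φ.isLinear r) hx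

/-- The values of a linear functional at the differences of the points of `V` and `x₀`. -/
def evalSub (V : Finset E) (x₀ : E) : Module.Dual ℝ E →ₗ[ℝ] (V → ℝ) :=
  LinearMap.pi fun v => Module.Dual.eval ℝ E ((v : E) - x₀)

@[simp] theorem evalSub_apply (V : Finset E) (x₀ : E) (φ : Module.Dual ℝ E) (v : V) :
    evalSub V x₀ φ v = φ ((v : E) - x₀) := rfl

theorem sub_mem_vectorSpan {V : Set E} {x₀ v : E} (hx₀ : x₀ ∈ affineSpan ℝ V) (hv : v ∈ V) :
    v - x₀ ∈ vectorSpan ℝ V := by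
  rw [← direction_affineSpan]
  exact AffineSubspace.vsub_mem_direction (mem_affineSpan ℝ hv) hx₀

theorem vectorSpan_le_of_sub_mem {V : Set E} {x₀ : E} {S : Submodule ℝ E}
    (h : ∀ v ∈ V, v - x₀ ∈ S) : vectorSpan ℝ V ≤ S := by
  rw [vectorSpan_def, Submodule.span_le]
  rintro _ ⟨v, hv, w, hw, rfl⟩
  have := S.sub_mem (h v hv) (h w hw)
  rwa [sub_sub_sub_cancel_right] at this

/-- The kernel is the annihilator of the direction space of `V`, so the range has the dimension of
that space's dual. -/
theorem finrank_range_evalSub [FiniteDimensional ℝ E] {V : Finset E} {x₀ : E}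
    (hx₀ : x₀ ∈ affineSpan ℝ (V : Set E)) :
    Module.finrank ℝ (LinearMap.range (evalSub V x₀)) =
      Module.finrank ℝ (vectorSpan ℝ (V : Set E)) := by
  have hker : LinearMap.ker (evalSub V x₀) = (vectorSpan ℝ (V : Set E)).dualAnnihilator := by
    ext φ
    rw [LinearMap.mem_ker, Submodule.mem_dualAnnihilator]
    constructor
    · intro h w hw
      exact vectorSpan_le_of_sub_mem (x₀ := x₀) (S := LinearMap.ker φ)
        (fun v hv => congrFun h ⟨v, hv⟩) hw
    · intro h
      ext v
      exact h _ (sub_mem_vectorSpan hx₀ v.2)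
  have h1 := LinearMap.finrank_range_add_finrank_ker (evalSub V x₀)
  have h2 := Subspace.finrank_add_finrank_dualAnnihilator_eq (vectorSpan ℝ (V : Set E))
  rw [hker, Subspace.dual_finrank_eq] at h1
  omega

theorem affDim_convexHull (V : Set E) :
    affDim (convexHull ℝ V) = Module.finrank ℝ (vectorSpan ℝ V) := by
  rw [affDim, affineSpan_convexHull, direction_affineSpan]

/-- The part of the convex hull of `V` where the affine functional `φ (x - x₀)` is `1`. -/
def levelFace (V : Finset E) (x₀ : E) (φ : Module.Dual ℝ E) : Set E :=
  {x | x ∈ convexHull ℝ (V : Set E) ∧ φ (x - x₀) = 1}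

/-- Otherwise some functional kills all tight vectors but not some `v - x₀`, a nonzero perturbation
of the extreme point. -/
theorem vectorSpan_le_span_tight {V : Finset E} {x₀ : E} {φ : Module.Dual ℝ E}
    (hφ : evalSub V x₀ φ ∈
      Set.extremePoints ℝ (polarBody (LinearMap.range (evalSub V x₀)))) :
    vectorSpan ℝ (V : Set E) ≤
      Submodule.span ℝ {w | ∃ v ∈ V, φ (v - x₀) = 1 ∧ w = v - x₀} := by
  refine vectorSpan_le_of_sub_mem (x₀ := x₀) fun v hv => ?_
  by_contra hmem
  obtain ⟨ψ, hψ, hle⟩ := Submodule.exists_le_ker_of_notMem hmem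
  refine hψ (congrFun (eq_zero_of_mem_extremePoints_polarBody hφ ⟨ψ, rfl⟩ fun i hi => ?_) ⟨v, hv⟩)
  exact hle (Submodule.subset_span ⟨i, i.2, hi, rfl⟩)

theorem isFacet_levelFace [FiniteDimensional ℝ E] {V : Finset E} {x₀ : E}
    (hx₀ : x₀ ∈ affineSpan ℝ (V : Set E)) (hV : vectorSpan ℝ (V : Set E) ≠ ⊥)
    {φ : Module.Dual ℝ E}
    (hφ : evalSub V x₀ φ ∈
      Set.extremePoints ℝ (polarBody (LinearMap.range (evalSub V x₀)))) :
    IsFacet (convexHull ℝ (V : Set E)) (levelFace V x₀ φ) := by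
  have hspan := vectorSpan_le_span_tight hφ
  obtain ⟨t, htV, ht⟩ : ∃ t ∈ V, φ (t - x₀) = 1 := by
    by_contra! h
    refine hV (le_bot_iff.1 (hspan.trans (Submodule.span_le.2 ?_)))
    rintro w ⟨v, hv, hv1, -⟩
    exact absurd hv1 (h v hv)
  have htQ : t ∈ levelFace V x₀ φ := ⟨subset_convexHull ℝ _ htV, ht⟩
  have hle : ∀ y ∈ convexHull ℝ (V : Set E), φ y ≤ φ t := fun y hy =>
    convexHull_subset_halfspace φ (fun v hv => by
      have h1 : φ (v - x₀) ≤ 1 := hφ.1.2 ⟨v, hv⟩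
      rw [map_sub] at h1 ht
      linarith) hy
  refine ⟨⟨t, htQ⟩, fun _ => ⟨LinearMap.toContinuousLinearMap φ, ?_⟩, ?_⟩
  · ext x
    constructor
    · rintro ⟨hx, hx1⟩
      refine ⟨hx, fun y hy => ?_⟩
      have := hle y hy
      rw [map_sub] at hx1 ht
      simp only [LinearMap.coe_toContinuousLinearMap']
      linarith
    · rintro ⟨hx, hx1⟩
      refine ⟨hx, ?_⟩
      have h1 := hle x hx
      have h2 := hx1 t htQ.1
      simp only [LinearMap.coe_toContinuousLinearMap'] at h2
      rw [map_sub] at ht ⊢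
      linarith
  · rw [affDim_convexHull, affDim, direction_affineSpan]
    set D := vectorSpan ℝ (levelFace V x₀ φ) with hD
    have hDV : D ≤ vectorSpan ℝ (V : Set E) := by
      rw [← direction_affineSpan, ← affineSpan_convexHull, direction_affineSpan]
      exact vectorSpan_mono ℝ fun x hx => hx.1
    have hDφ : D ≤ LinearMap.ker φ :=
      vectorSpan_le_of_sub_mem (x₀ := t) fun v hv => by
        have h1 := hv.2
        rw [LinearMap.mem_ker, map_sub]
        rw [map_sub] at h1 ht
        linarith
    have hlt : D < vectorSpan ℝ (V : Set E) := by
      refine lt_of_le_of_ne hDV fun h => ?_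
      have h1 : t - x₀ ∈ D := h ▸ sub_mem_vectorSpan hx₀ htV
      have h2 : φ (t - x₀) = 0 := hDφ h1
      exact one_ne_zero (ht.symm.trans h2)
    -- Tight vectors differ from `t - x₀` by elements of `D`, so `D` has codimension at most one;
    -- `hlt` makes it exactly one.
    have hsup : vectorSpan ℝ (V : Set E) ≤ D ⊔ Submodule.span ℝ {t - x₀} := by
      refine hspan.trans (Submodule.span_le.2 ?_)
      rintro w ⟨v, hv, hv1, rfl⟩
      have h1 : v - t ∈ D :=
        vsub_mem_vectorSpan ℝ (show v ∈ levelFace V x₀ φ from ⟨subset_convexHull ℝ _ hv, hv1⟩) htQ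
      have := Submodule.add_mem_sup h1 (Submodule.mem_span_singleton_self (R := ℝ) (t - x₀))
      rwa [sub_add_sub_cancel] at this
    have h1 := Submodule.finrank_lt_finrank_of_lt hlt
    have h2 := (Submodule.finrank_mono hsup).trans (Submodule.finrank_add_le_finrank_add_finrank _ _)
    have h3 := finrank_span_le_card (R := ℝ) {t - x₀}
    simp only [Set.toFinset_singleton, Finset.card_singleton] at h3
    omega

theorem evalSub_eq_of_levelFace_eq {V : Finset E} {x₀ : E} {φ ψ : Module.Dual ℝ E}
    (hφ : evalSub V x₀ φ ∈
      Set.extremePoints ℝ (polarBody (LinearMap.range (evalSub V x₀))))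
    (h : levelFace V x₀ φ = levelFace V x₀ ψ) : evalSub V x₀ φ = evalSub V x₀ ψ := by
  rw [← sub_eq_zero]
  refine eq_zero_of_mem_extremePoints_polarBody hφ ⟨φ - ψ, map_sub _ _ _⟩ fun i hi => ?_
  have hmem : (i : E) ∈ levelFace V x₀ ψ := h ▸ ⟨subset_convexHull ℝ _ i.2, hi⟩
  rw [Pi.sub_apply, hi, evalSub_apply, hmem.2, sub_self]

theorem affDim_le_encard_facets [FiniteDimensional ℝ E] {Q : Set E} (hQ : IsPolytope Q) :
    (affDim Q : ℕ∞) ≤ {F | IsFacet Q F}.encard := by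
  obtain ⟨V, rfl⟩ := hQ
  rw [affDim_convexHull]
  rcases eq_or_ne (vectorSpan ℝ (V : Set E)) ⊥ with hbot | hbot
  · have h0 : Module.finrank ℝ (vectorSpan ℝ (V : Set E)) = 0 := by rw [hbot, finrank_bot]
    exact (congrArg Nat.cast h0).trans_le zero_le
  have hne : V.Nonempty := by
    rw [Finset.nonempty_iff_ne_empty]
    rintro rfl
    exact hbot (by rw [Finset.coe_empty, vectorSpan_empty])
  have hcard : (0 : ℝ) < V.card := by exact_mod_cast hne.card_pos
  set x₀ := V.centerMass (fun _ => (1 : ℝ)) id with hx₀_def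
  have hx₀ : x₀ ∈ affineSpan ℝ (V : Set E) :=
    convexHull_subset_affineSpan _ (Finset.centerMass_id_mem_convexHull V
      (fun _ _ => zero_le_one) (by simpa using hcard))
  -- The centroid is chosen for this identity, which makes the polar body compact.
  have hsum : ∑ v : V, ((v : E) - x₀) = 0 := by
    rw [Finset.sum_coe_sort V fun v => v - x₀, Finset.sum_sub_distrib, Finset.sum_const,
      hx₀_def, Finset.centerMass]
    simp only [one_smul, id, Finset.sum_const, nsmul_eq_mul, mul_one]
    rw [← Nat.cast_smul_eq_nsmul ℝ, smul_inv_smul₀ hcard.ne', sub_self]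
  set L := LinearMap.range (evalSub V x₀) with hL_def
  have hL : ∀ a ∈ L, ∑ i, a i = 0 := by
    rintro _ ⟨φ, rfl⟩
    simp only [evalSub_apply]
    rw [← map_sum, hsum, map_zero]
  have hrange : ∀ a : Set.extremePoints ℝ (polarBody L), ∃ φ, evalSub V x₀ φ = a :=
    fun a => a.2.1.1
  choose Φ hΦ using hrange
  have hext : ∀ a : Set.extremePoints ℝ (polarBody L), evalSub V x₀ (Φ a) ∈
      Set.extremePoints ℝ (polarBody L) := fun a => (hΦ a).symm ▸ a.2
  have hinj : Function.Injective fun a => levelFace V x₀ (Φ a) := fun a b hab =>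
    Subtype.ext (by rw [← hΦ a, ← hΦ b, evalSub_eq_of_levelFace_eq (hext a) hab])
  have hsub : Set.range (fun a => levelFace V x₀ (Φ a)) ⊆
      {F | IsFacet (convexHull ℝ (V : Set E)) F} := by
    rintro _ ⟨a, rfl⟩
    exact isFacet_levelFace hx₀ hbot (hext a)
  refine le_trans ?_ (Set.encard_le_encard hsub)
  rw [← Set.image_univ, hinj.encard_image, Set.encard_univ]
  change _ ≤ (Set.extremePoints ℝ (polarBody L)).encard
  rcases (Set.extremePoints ℝ (polarBody L)).finite_or_infinite with hfin | hinf
  · rw [← finrank_range_evalSub hx₀, hfin.encard_eq_coe_toFinset_card, Nat.cast_le]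
    have := Submodule.finrank_mono (le_span_extremePoints_polarBody hL)
    rw [← hfin.coe_toFinset] at this
    exact this.trans (finrank_span_finset_le_card _)
  · simp [hinf.encard_eq]

/-- A facet is recovered from its extreme points, which form a subset of the finite set `V`. -/
theorem finite_facets {Q : Set E} (hQ : IsPolytope Q) : {F | IsFacet Q F}.Finite := by
  obtain ⟨V, rfl⟩ := hQ
  refine (V.finite_toSet.finite_subsets.image fun s => closure (convexHull ℝ s)).subset ?_
  rintro F ⟨-, hF, -⟩
  refine ⟨Set.extremePoints ℝ F, ?_, closure_convexHull_extremePoints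
    (hF.isCompact (V.finite_toSet.isCompact_convexHull ℝ)) (hF.convex (convex_convexHull ℝ _))⟩
  exact hF.isExtreme.extremePoints_subset_extremePoints.trans
    (extremePoints_convexHull_subset (𝕜 := ℝ))

/-- The extension complexity of a polytope is at least its dimension. -/
theorem affDim_le_extensionComplexity [FiniteDimensional ℝ E] {P : Set E} (hP : IsPolytope P) :
    affDim P ≤ extensionComplexity P := by
  -- `sInf ∅ = 0` in `ℕ`, so an extension must be exhibited: `P` itself, in coordinates.
  have hne : {r | HasExtensionOfSize P r}.Nonempty := by
    obtain ⟨V, rfl⟩ := hP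
    classical
    let f := (Module.finBasis ℝ E).equivFun
    have hQ : IsPolytope (convexHull ℝ ((V.image f : Finset _) : Set (Fin _ → ℝ))) := ⟨V.image f, rfl⟩
    refine ⟨(finite_facets hQ).toFinset.card, _, _, f.symm.toLinearMap, hQ, ?_,
      (finite_facets hQ).encard_eq_coe_toFinset_card⟩
    rw [LinearMap.image_convexHull, Finset.coe_image, ← Set.image_comp]
    simp
  obtain ⟨m, Q, π, hQ, rfl, hr⟩ := Nat.sInf_mem hne
  have h1 := affDim_le_encard_facets hQ
  rw [hr, Nat.cast_le] at h1
  refine le_trans ?_ h1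
  rw [affDim, affDim, direction_affineSpan, direction_affineSpan]
  have h2 : vectorSpan ℝ (π '' Q) = (vectorSpan ℝ Q).map π := by
    have := AffineMap.map_vectorSpan (s := Q) π.toAffineMap
    simpa using this.symm
  rw [h2]
  exact Submodule.finrank_map_le _ _

end Polytope

namespace Blotto

variable {K N : ℕ}

/-! ### Edges and canonical paths. -/

section Edges

/-- The edge from `v_{k,i}` to `v_{k+1,j}`. -/
def mkEdge (k i j : ℕ) (hk : k < K) (hij : i ≤ j) (hj : j ≤ N) : Edge K N :=
  ⟨(⟨k, hk⟩, ⟨i, by omega⟩, ⟨j, by omega⟩), hij⟩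

theorem Edge.eq_of_layer_tail_head {e e' : Edge K N} (h₁ : e.layer = e'.layer)
    (h₂ : e.tail = e'.tail) (h₃ : e.head = e'.head) : e = e' :=
  Subtype.ext (Prod.ext (Fin.ext h₁) (Prod.ext (Fin.ext h₂) (Fin.ext h₃)))

theorem Edge.layer_lt (e : Edge K N) : e.layer < K := e.1.1.2

theorem Edge.tail_le_head (e : Edge K N) : e.tail ≤ e.head := e.2

theorem Edge.head_le (e : Edge K N) : e.head ≤ N := Nat.lt_succ_iff.1 e.1.2.2.2

theorem Edge.tail_le (e : Edge K N) : e.tail ≤ N := e.tail_le_head.trans e.head_le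

end Edges

section Paths

theorem sum_filter_lt_succ (f : Fin K → ℕ) {k : ℕ} (hk : k < K) :
    ∑ i : Fin K with i.val < k + 1, f i = ∑ i : Fin K with i.val < k, f i + f ⟨k, hk⟩ := by
  have : (Finset.univ.filter fun i : Fin K => i.val < k + 1) =
      insert ⟨k, hk⟩ (Finset.univ.filter fun i : Fin K => i.val < k) := by
    ext i
    simp only [Finset.mem_filter, Finset.mem_univ, true_and, Finset.mem_insert, Fin.ext_iff]
    omega
  rw [this, Finset.sum_insert (by simp), add_comm]

namespace PureStrategy

theorem prefixSum_succ (s : PureStrategy K N) {k : ℕ} (hk : k < K) :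
    s.prefixSum (k + 1) = s.prefixSum k + (s.1 ⟨k, hk⟩ : ℕ) :=
  sum_filter_lt_succ (fun i => (s.1 i : ℕ)) hk

theorem prefixSum_zero (s : PureStrategy K N) : s.prefixSum 0 = 0 := by
  simp [prefixSum]

theorem prefixSum_last (s : PureStrategy K N) : s.prefixSum K = N := by
  simpa [prefixSum] using s.2

theorem prefixSum_le_succ (s : PureStrategy K N) {k : ℕ} (hk : k < K) :
    s.prefixSum k ≤ s.prefixSum (k + 1) := by
  rw [s.prefixSum_succ hk]
  exact Nat.le_add_right _ _

theorem prefixSum_le (s : PureStrategy K N) (k : ℕ) : s.prefixSum k ≤ N := by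
  refine (Finset.sum_le_sum_of_subset (Finset.filter_subset _ _)).trans s.2.le

/-- The edge of the canonical path of `s` that starts in layer `k`. -/
def pathEdge (s : PureStrategy K N) (k : ℕ) (hk : k < K) : Edge K N :=
  mkEdge k (s.prefixSum k) (s.prefixSum (k + 1)) hk (s.prefixSum_le_succ hk) (s.prefixSum_le _)

theorem uses_pathEdge (s : PureStrategy K N) (k : ℕ) (hk : k < K) : s.Uses (s.pathEdge k hk) :=
  ⟨rfl, rfl⟩

/-- The flow that sends one unit along the canonical path of `s`. -/
def pathFlow (s : PureStrategy K N) (e : Edge K N) : ℝ :=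
  if s.Uses e then 1 else 0

end PureStrategy

theorem sum_filter_lt_sub {p : ℕ → ℕ} (h0 : p 0 = 0) (hp : ∀ k < K, p k ≤ p (k + 1)) {k : ℕ}
    (hk : k ≤ K) : ∑ i : Fin K with i.val < k, (p (i + 1) - p i) = p k := by
  induction k with
  | zero => simp [h0]
  | succ k ih =>
    rw [sum_filter_lt_succ (fun i : Fin K => p (i + 1) - p i) hk, ih (by omega)]
    exact Nat.add_sub_cancel' (hp k hk)

theorem sum_sub_eq {p : ℕ → ℕ} (h0 : p 0 = 0) (hp : ∀ k < K, p k ≤ p (k + 1)) :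
    ∑ i : Fin K, (p (i + 1) - p i) = p K := by
  rw [← sum_filter_lt_sub h0 hp le_rfl]
  simp

/-- Every monotone path from `v_{0,0}` to `v_{K,N}` is the canonical path of a pure strategy. -/
theorem exists_pureStrategy_of_path {p : ℕ → ℕ} (h0 : p 0 = 0)
    (hp : ∀ k < K, p k ≤ p (k + 1)) (hK : p K = N) :
    ∃ s : PureStrategy K N, ∀ k ≤ K, s.prefixSum k = p k := by
  have hsum := (sum_sub_eq h0 hp).trans hK
  have hle : ∀ i : Fin K, p (i + 1) - p i < N + 1 := fun i => Nat.lt_succ_of_le <| by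
    rw [← hsum]
    exact Finset.single_le_sum (f := fun i : Fin K => p (i + 1) - p i)
      (fun _ _ => Nat.zero_le _) (Finset.mem_univ i)
  exact ⟨⟨fun i => ⟨p (i + 1) - p i, hle i⟩, hsum⟩, fun k hk => sum_filter_lt_sub h0 hp hk⟩

end Paths

/-! ### Unit flows and their decomposition into paths. -/

section Flows

theorem outflow_smul_add_smul (a b : ℝ) (F G : Edge K N → ℝ) (k l : ℕ) :
    outflow (a • F + b • G) k l = a * outflow F k l + b * outflow G k l := by
  simp [outflow, Finset.sum_add_distrib, Finset.mul_sum]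

theorem inflow_smul_add_smul (a b : ℝ) (F G : Edge K N → ℝ) (k l : ℕ) :
    inflow (a • F + b • G) k l = a * inflow F k l + b * inflow G k l := by
  simp [inflow, Finset.sum_add_distrib, Finset.mul_sum]

theorem IsUnitFlow.smul_add_smul {F G : Edge K N → ℝ} (hF : IsUnitFlow F) (hG : IsUnitFlow G)
    {a b : ℝ} (hab : a + b = 1) (hnonneg : ∀ e, 0 ≤ (a • F + b • G) e) :
    IsUnitFlow (a • F + b • G) where
  nonneg := hnonneg
  conservation k l h1 h2 h3 := by
    rw [inflow_smul_add_smul, outflow_smul_add_smul, hF.conservation k l h1 h2 h3,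
      hG.conservation k l h1 h2 h3]
  source := by rw [outflow_smul_add_smul, hF.source, hG.source, mul_one, mul_one, hab]
  no_other_source l h1 h2 := by
    rw [outflow_smul_add_smul, hF.no_other_source l h1 h2, hG.no_other_source l h1 h2, mul_zero,
      mul_zero, add_zero]
  sink := by rw [inflow_smul_add_smul, hF.sink, hG.sink, mul_one, mul_one, hab]

theorem convex_membershipPolytope : Convex ℝ (membershipPolytope K N) :=
  fun _ hF _ hG _ _ ha hb hab => hF.smul_add_smul hG hab fun e =>
    add_nonneg (mul_nonneg ha (hF.nonneg e)) (mul_nonneg hb (hG.nonneg e))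

theorem outflow_pathFlow (s : PureStrategy K N) {k : ℕ} (hk : k < K) (l : ℕ) :
    outflow s.pathFlow k l = if s.prefixSum k = l then 1 else 0 := by
  rw [outflow]
  split_ifs with h
  · rw [Finset.sum_eq_single_of_mem (s.pathEdge k hk)]
    · exact if_pos (s.uses_pathEdge k hk)
    · exact Finset.mem_filter.2 ⟨Finset.mem_univ _, rfl, h⟩
    · intro e he hne
      obtain ⟨-, h1, h2⟩ := Finset.mem_filter.1 he
      refine if_neg fun hu => hne ?_
      exact Edge.eq_of_layer_tail_head h1 (h2.trans h.symm)
        (by rw [← hu.2, h1]; rfl)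
  · refine Finset.sum_eq_zero fun e he => if_neg fun hu => h ?_
    obtain ⟨-, h1, h2⟩ := Finset.mem_filter.1 he
    rw [← h1, ← h2, hu.1]

theorem inflow_pathFlow (s : PureStrategy K N) {k : ℕ} (hk : k < K) (l : ℕ) :
    inflow s.pathFlow (k + 1) l = if s.prefixSum (k + 1) = l then 1 else 0 := by
  rw [inflow]
  split_ifs with h
  · rw [Finset.sum_eq_single_of_mem (s.pathEdge k hk)]
    · exact if_pos (s.uses_pathEdge k hk)
    · exact Finset.mem_filter.2 ⟨Finset.mem_univ _, rfl, h⟩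
    · intro e he hne
      obtain ⟨-, h1, h2⟩ := Finset.mem_filter.1 he
      have h1 := Nat.succ_injective h1
      refine if_neg fun hu => hne ?_
      exact Edge.eq_of_layer_tail_head h1 (by rw [← hu.1, h1]; rfl) (h2.trans h.symm)
  · refine Finset.sum_eq_zero fun e he => if_neg fun hu => h ?_
    obtain ⟨-, h1, h2⟩ := Finset.mem_filter.1 he
    rw [← h1, ← h2, hu.2]

theorem isUnitFlow_pathFlow (hK : 0 < K) (s : PureStrategy K N) : IsUnitFlow s.pathFlow where
  nonneg e := by
    rw [PureStrategy.pathFlow]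
    split_ifs <;> norm_num
  conservation k l h1 h2 _ := by
    obtain ⟨k, rfl⟩ := Nat.exists_eq_add_of_le' h1
    rw [inflow_pathFlow s (by omega), outflow_pathFlow s (by omega)]
  source := by rw [outflow_pathFlow s hK, if_pos s.prefixSum_zero]
  no_other_source l hl _ := by
    rw [outflow_pathFlow s hK, s.prefixSum_zero, if_neg hl.ne]
  sink := by
    obtain ⟨k, rfl⟩ := Nat.exists_eq_add_of_le' hK
    rw [inflow_pathFlow s (by omega), if_pos s.prefixSum_last]

theorem sum_outflow (F : Edge K N → ℝ) (k : ℕ) :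
    ∑ l ∈ Finset.range (N + 1), outflow F k l = ∑ e : Edge K N with e.layer = k, F e := by
  rw [← Finset.sum_fiberwise_of_maps_to (t := Finset.range (N + 1)) (g := fun e : Edge K N => e.tail)
    (fun e _ => Finset.mem_range.2 (Nat.lt_succ_of_le e.tail_le))]
  simp only [Finset.filter_filter, outflow]

theorem sum_inflow (F : Edge K N → ℝ) (k : ℕ) :
    ∑ l ∈ Finset.range (N + 1), inflow F (k + 1) l = ∑ e : Edge K N with e.layer = k, F e := by
  rw [← Finset.sum_fiberwise_of_maps_to (t := Finset.range (N + 1)) (g := fun e : Edge K N => e.head)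
    (fun e _ => Finset.mem_range.2 (Nat.lt_succ_of_le e.head_le))]
  simp only [Finset.filter_filter, inflow, Nat.add_right_cancel_iff]

namespace IsUnitFlow

variable {F : Edge K N → ℝ}

theorem sum_layer (hF : IsUnitFlow F) {k : ℕ} (hk : k < K) :
    ∑ e : Edge K N with e.layer = k, F e = 1 := by
  induction k with
  | zero =>
    rw [← sum_outflow, Finset.sum_eq_single_of_mem 0 (by simp), hF.source]
    intro l hl hl0
    exact hF.no_other_source l (Nat.pos_of_ne_zero hl0) (Nat.lt_succ_iff.1 (Finset.mem_range.1 hl))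
  | succ k ih =>
    rw [← ih (by omega), ← sum_outflow, ← sum_inflow]
    exact Finset.sum_congr rfl fun l hl => (hF.conservation (k + 1) l (by omega) (by omega)
      (Nat.lt_succ_iff.1 (Finset.mem_range.1 hl))).symm

theorem le_one (hF : IsUnitFlow F) (e : Edge K N) : F e ≤ 1 := by
  rw [← hF.sum_layer e.layer_lt]
  exact Finset.single_le_sum (f := F) (fun e _ => hF.nonneg e)
    (Finset.mem_filter.2 ⟨Finset.mem_univ e, rfl⟩)

theorem le_inflow (hF : IsUnitFlow F) (e : Edge K N) : F e ≤ inflow F (e.layer + 1) e.head :=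
  Finset.single_le_sum (f := F) (fun e _ => hF.nonneg e)
    (Finset.mem_filter.2 ⟨Finset.mem_univ e, rfl, rfl⟩)

theorem exists_pos_of_outflow_pos (hF : IsUnitFlow F) {k l : ℕ} (h : 0 < outflow F k l) :
    ∃ e : Edge K N, e.layer = k ∧ e.tail = l ∧ 0 < F e := by
  obtain ⟨e, he, hne⟩ := Finset.exists_ne_zero_of_sum_ne_zero h.ne'
  obtain ⟨-, h1, h2⟩ := Finset.mem_filter.1 he
  exact ⟨e, h1, h2, lt_of_le_of_ne (hF.nonneg e) hne.symm⟩

/-- The last layer carries total flow `1`, all of which already enters `v_{K,N}`, so nothing is left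
for other heads. -/
theorem head_eq_of_pos (hF : IsUnitFlow F) {e : Edge K N} (he : e.layer + 1 = K)
    (hpos : 0 < F e) : e.head = N := by
  by_contra hne
  have h1 := sum_inflow F e.layer
  rw [hF.sum_layer e.layer_lt, ← Finset.add_sum_erase _ _ (Finset.self_mem_range_succ N)] at h1
  have h2 : inflow F (e.layer + 1) e.head ≤
      ∑ l ∈ (Finset.range (N + 1)).erase N, inflow F (e.layer + 1) l :=
    Finset.single_le_sum (f := fun l => inflow F (e.layer + 1) l)
      (fun l _ => Finset.sum_nonneg fun e _ => hF.nonneg e)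
      (Finset.mem_erase.2 ⟨hne, Finset.mem_range.2 (Nat.lt_succ_of_le e.head_le)⟩)
  have h3 := hF.sink
  have h4 := hF.le_inflow e
  rw [he] at h1 h2 h4
  linarith

/-- Conservation lets a path of positive edges be extended greedily: positive inflow at a vertex
forces a positive outgoing edge. -/
theorem exists_partial_path (hF : IsUnitFlow F) (n : ℕ) (hn : n < K) :
    ∃ p : ℕ → ℕ, p 0 = 0 ∧ ∀ k ≤ n, ∃ e : Edge K N,
      e.layer = k ∧ e.tail = p k ∧ e.head = p (k + 1) ∧ 0 < F e := by
  induction n with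
  | zero =>
    obtain ⟨e, h1, h2, h3⟩ := hF.exists_pos_of_outflow_pos (k := 0) (l := 0)
      (by rw [hF.source]; exact one_pos)
    refine ⟨fun k => if k = 0 then 0 else e.head, rfl, fun k hk => ⟨e, ?_⟩⟩
    obtain rfl : k = 0 := by omega
    exact ⟨h1, h2, rfl, h3⟩
  | succ n ih =>
    obtain ⟨p, h0, hp⟩ := ih (by omega)
    obtain ⟨e, h1, h2, h3, h4⟩ := hp n le_rfl
    obtain ⟨e', h1', h2', h4'⟩ := hF.exists_pos_of_outflow_pos (k := n + 1) (l := e.head) (by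
      rw [← hF.conservation (n + 1) e.head (by omega) (by omega) e.head_le, ← h1]
      exact h4.trans_le (hF.le_inflow e))
    refine ⟨fun k => if k = n + 2 then e'.head else p k, by simpa using h0, fun k hk => ?_⟩
    rcases Nat.le_succ_iff.1 hk with hk | rfl
    · have := hp k hk
      dsimp only
      rwa [if_neg (by omega), if_neg (by omega)]
    · refine ⟨e', h1', ?_, (if_pos rfl).symm, h4'⟩
      rw [h2', h3]
      exact (if_neg (by simp)).symm

theorem exists_pureStrategy (hF : IsUnitFlow F) (hK : 0 < K) :
    ∃ s : PureStrategy K N, ∀ e, s.Uses e → 0 < F e := by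
  obtain ⟨p, h0, hp⟩ := hF.exists_partial_path (K - 1) (by omega)
  obtain ⟨s, hs⟩ := exists_pureStrategy_of_path (K := K) (N := N) h0
    (fun k hk => by
      obtain ⟨e, h1, h2, h3, h4⟩ := hp k (by omega)
      rw [← h2, ← h3]
      exact e.tail_le_head)
    (by
      obtain ⟨e, h1, h2, h3, h4⟩ := hp (K - 1) le_rfl
      rw [Nat.sub_add_cancel hK] at h3
      rw [← h3]
      exact hF.head_eq_of_pos (by omega) h4)
  refine ⟨s, fun e he => ?_⟩
  have hlt := e.layer_lt
  obtain ⟨e', h1, h2, h3, h4⟩ := hp e.layer (by omega)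
  have : e' = e := Edge.eq_of_layer_tail_head h1
    (by rw [h2, ← he.1, hs _ hlt.le]) (by rw [h3, ← he.2, hs _ hlt])
  exact this ▸ h4

end IsUnitFlow

theorem continuous_outflow (k l : ℕ) : Continuous fun F : Edge K N → ℝ => outflow F k l :=
  continuous_finsetSum _ fun e _ => continuous_apply e

theorem continuous_inflow (k l : ℕ) : Continuous fun F : Edge K N → ℝ => inflow F k l :=
  continuous_finsetSum _ fun e _ => continuous_apply e

theorem isClosed_membershipPolytope : IsClosed (membershipPolytope K N) := by
  have : membershipPolytope K N = {F | (∀ e, 0 ≤ F e) ∧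
      (∀ k l, 1 ≤ k → k + 1 ≤ K → l ≤ N → inflow F k l = outflow F k l) ∧ outflow F 0 0 = 1 ∧
      (∀ l, 0 < l → l ≤ N → outflow F 0 l = 0) ∧ inflow F K N = 1} := by
    ext F
    exact ⟨fun h => ⟨h.1, h.2, h.3, h.4, h.5⟩, fun ⟨h1, h2, h3, h4, h5⟩ => ⟨h1, h2, h3, h4, h5⟩⟩
  rw [this]
  simp only [Set.ofPred_and, Set.ofPred_forall]
  refine (isClosed_iInter fun e => isClosed_le continuous_const (continuous_apply e)).inter
    ((isClosed_iInter fun k => isClosed_iInter fun l => isClosed_iInter fun _ =>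
      isClosed_iInter fun _ => isClosed_iInter fun _ =>
        isClosed_eq (continuous_inflow k l) (continuous_outflow k l)).inter
    ((isClosed_eq (continuous_outflow 0 0) continuous_const).inter
    ((isClosed_iInter fun l => isClosed_iInter fun _ => isClosed_iInter fun _ =>
      isClosed_eq (continuous_outflow 0 l) continuous_const).inter
    (isClosed_eq (continuous_inflow K N) continuous_const))))

theorem isCompact_membershipPolytope : IsCompact (membershipPolytope K N) :=
  (isCompact_univ_pi fun _ : Edge K N => isCompact_Icc (a := (0 : ℝ)) (b := 1)).of_isClosed_subset
    isClosed_membershipPolytope fun _ hF e _ => ⟨hF.nonneg e, hF.le_one e⟩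

/-- Write `F` as `δ` times a path in its support plus `1 - δ` times the normalized remainder, again
a unit flow; extremality identifies `F` with the path flow. -/
theorem extremePoints_membershipPolytope_subset (hK : 0 < K) :
    Set.extremePoints ℝ (membershipPolytope K N) ⊆
      Set.range (PureStrategy.pathFlow (K := K) (N := N)) := by
  intro F hF
  have hFu : IsUnitFlow F := hF.1
  obtain ⟨s, hs⟩ := hFu.exists_pureStrategy hK
  obtain ⟨ε, hε, h⟩ := exists_pos_forall_mul_abs_le s.pathFlow
    (fun e => if s.Uses e then F e else 1) fun e => by
      split_ifs with hu
      · exact hs e hu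
      · exact one_pos
  obtain ⟨δ, hδ, hδε, hδ1⟩ : ∃ δ : ℝ, 0 < δ ∧ δ ≤ ε ∧ δ < 1 :=
    ⟨min ε (1 / 2), lt_min hε (by norm_num), min_le_left _ _,
      (min_le_right _ _).trans_lt (by norm_num)⟩
  have hδ' : 0 < 1 - δ := sub_pos.2 hδ1
  have hG : IsUnitFlow ((1 - δ)⁻¹ • F + (-(1 - δ)⁻¹ * δ) • s.pathFlow) := by
    refine hFu.smul_add_smul (isUnitFlow_pathFlow hK s) (by field_simp; ring) fun e => ?_
    have hle : δ * s.pathFlow e ≤ F e := by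
      have h1 := h e
      rw [PureStrategy.pathFlow] at h1 ⊢
      split_ifs at h1 ⊢ with hu
      · rw [abs_one] at h1
        linarith
      · rw [mul_zero]
        exact hFu.nonneg e
    have h2 : ((1 - δ)⁻¹ • F + (-(1 - δ)⁻¹ * δ) • s.pathFlow) e =
        (1 - δ)⁻¹ * (F e - δ * s.pathFlow e) := by
      simp only [Pi.add_apply, Pi.smul_apply, smul_eq_mul]
      ring
    rw [h2]
    exact mul_nonneg (inv_nonneg.2 hδ'.le) (sub_nonneg.2 hle)
  refine ⟨s, hF.2 (isUnitFlow_pathFlow hK s) hG ⟨δ, 1 - δ, hδ, hδ', by ring, ?_⟩⟩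
  ext e
  simp only [Pi.add_apply, Pi.smul_apply, smul_eq_mul]
  field_simp
  ring

/-- The membership polytope is the convex hull of the flows along the canonical paths. -/
theorem membershipPolytope_eq_convexHull (hK : 0 < K) :
    membershipPolytope K N = convexHull ℝ (Set.range (PureStrategy.pathFlow (K := K) (N := N))) := by
  apply Set.Subset.antisymm
  · rw [← closure_convexHull_extremePoints isCompact_membershipPolytope convex_membershipPolytope]
    exact closure_minimal (convexHull_mono (extremePoints_membershipPolytope_subset hK))
      ((Set.finite_range _).isClosed_convexHull ℝ)
  · refine convexHull_min ?_ convex_membershipPolytope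
    rintro _ ⟨s, rfl⟩
    exact isUnitFlow_pathFlow hK s

theorem isPolytope_membershipPolytope (hK : 0 < K) : IsPolytope (membershipPolytope K N) :=
  ⟨(Set.finite_range (PureStrategy.pathFlow (K := K) (N := N))).toFinset, by
    rw [Set.Finite.coe_toFinset, membershipPolytope_eq_convexHull hK]⟩

/-- The map is linear and sends the vertices of the simplex to the path flows. -/
theorem flowOfMixed_image_stdSimplex :
    flowOfMixed '' stdSimplex ℝ (PureStrategy K N) =
      convexHull ℝ (Set.range (PureStrategy.pathFlow (K := K) (N := N))) := by
  let f : (PureStrategy K N → ℝ) →ₗ[ℝ] (Edge K N → ℝ) :=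
    Fintype.linearCombination ℝ PureStrategy.pathFlow
  have hf : flowOfMixed = f := by
    ext x e
    simp [flowOfMixed, f, Fintype.linearCombination_apply, Finset.sum_apply,
      PureStrategy.pathFlow, Finset.sum_filter]
  rw [hf, ← convexHull_basis_eq_stdSimplex, LinearMap.image_convexHull, ← Set.range_comp]
  congr 2
  ext s e
  simp only [f, Function.comp_apply, Fintype.linearCombination_apply, ite_smul, one_smul,
    zero_smul, Finset.sum_ite_eq, Finset.mem_univ, if_true]

end Flows

/-! ### Dimension of the membership polytope. -/

section Dimension

/-- An index `⟨k, j, i⟩` for the edge from `v_{k+1,i}` to `v_{k+2,j}`, where `k < K - 2` and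
`i ≤ j < N`. -/
abbrev InnerEdge (K N : ℕ) : Type := Fin (K - 2) × Σ j : Fin N, Fin (j + 1)

/-- The edge with a given index. -/
def InnerEdge.edge (x : InnerEdge K N) : Edge K N :=
  mkEdge (x.1 + 1) x.2.2 x.2.1 (by omega) (by omega) (by omega)

theorem InnerEdge.edge_injective : Function.Injective (InnerEdge.edge (K := K) (N := N)) := by
  rintro ⟨k, j, i⟩ ⟨k', j', i'⟩ h
  simp only [edge, mkEdge, Subtype.mk.injEq, Prod.mk.injEq, Fin.mk.injEq,
    Nat.add_right_cancel_iff] at h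
  obtain ⟨h1, h2, h3⟩ := h
  obtain rfl := Fin.ext h1
  obtain rfl := Fin.ext h3
  obtain rfl := Fin.ext h2
  rfl

theorem InnerEdge.exists_pureStrategy (x : InnerEdge K N) :
    ∃ s : PureStrategy K N, s.Uses x.edge ∧
      ∀ y : InnerEdge K N, s.Uses y.edge → x.1 ≤ y.1 → y = x := by
  -- The path stays at `0`, traverses the given edge, then jumps to `N`; its later edges have head
  -- `N` and so are not inner.
  obtain ⟨s, hs⟩ := exists_pureStrategy_of_path (K := K) (N := N)
    (p := fun m => if m < x.1 + 1 then 0 else if m = x.1 + 1 then x.2.2 else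
      if m = x.1 + 2 then x.2.1 else N) (by simp)
    (fun m _ => by
      have := x.2.1.2
      have := x.2.2.2
      split_ifs <;> omega)
    (by
      have := x.1.2
      rw [if_neg (by omega), if_neg (by omega), if_neg (by omega)])
  refine ⟨s, ⟨?_, ?_⟩, fun y hy hxy => edge_injective ?_⟩
  · rw [hs _ x.edge.layer_lt.le]
    simp [edge, mkEdge]
  · have h5 : x.edge.layer = x.1 + 1 := rfl
    rw [hs _ x.edge.layer_lt, h5, if_neg (by omega), if_neg (by omega), if_pos rfl]
    rfl
  · have h1 := hy.1
    have h2 := hy.2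
    rw [hs _ y.edge.layer_lt.le] at h1
    rw [hs _ y.edge.layer_lt] at h2
    have h3 : (x.1 : ℕ) ≤ y.1 := hxy
    have h4 := y.2.1.2
    have h5 : y.edge.layer = y.1 + 1 := rfl
    have h6 : y.edge.head = y.2.1 := rfl
    have h7 : (y.1 : ℕ) = x.1 := by
      rw [h5, h6] at h2
      by_contra hne
      rw [if_neg (by omega), if_neg (by omega), if_neg (by omega)] at h2
      omega
    rw [h5, if_neg (by omega), if_pos (by omega)] at h1
    rw [h5, if_neg (by omega), if_neg (by omega), if_pos (by omega)] at h2
    exact Edge.eq_of_layer_tail_head (congrArg (· + 1) h7) h1.symm h2.symm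

theorem exists_pureStrategy_forall_not_uses (hK : 0 < K) :
    ∃ s : PureStrategy K N, ∀ y : InnerEdge K N, ¬ s.Uses y.edge := by
  -- Placing all troops on the first battlefield gives only edges with head `N`.
  obtain ⟨s, hs⟩ := exists_pureStrategy_of_path (K := K) (N := N)
    (p := fun m => if m = 0 then 0 else N) (by simp)
    (fun m _ => by by_cases h : m = 0 <;> simp [h])
    (by rw [if_neg hK.ne'])
  refine ⟨s, fun y hy => ?_⟩
  have h2 := hy.2
  rw [hs _ y.edge.layer_lt, if_neg (by omega)] at h2
  have h4 := y.2.1.2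
  have h6 : y.edge.head = y.2.1 := rfl
  omega

theorem card_innerEdge_le_affDim (hK : 0 < K) :
    Fintype.card (InnerEdge K N) ≤ affDim (membershipPolytope K N) := by
  choose s hs hs' using InnerEdge.exists_pureStrategy (K := K) (N := N)
  obtain ⟨s₀, hs₀⟩ := exists_pureStrategy_forall_not_uses (N := N) hK
  have hli : LinearIndependent ℝ fun x => (s x).pathFlow - s₀.pathFlow := by
    rw [Fintype.linearIndependent_iff]
    intro g hg
    by_contra! hne
    obtain ⟨i, hi⟩ := hne
    classical
    -- In the coordinate of an inner edge `x` from the last layer with a nonzero coefficient, only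
    -- the term of `x` survives.
    obtain ⟨x, hx, hmax⟩ := Finset.exists_max_image (Finset.univ.filter fun x => g x ≠ 0)
      (fun x => x.1) ⟨i, by simpa using hi⟩
    refine (Finset.mem_filter.1 hx).2 ?_
    have h := congrFun hg x.edge
    rw [Finset.sum_apply, Finset.sum_eq_single x] at h
    · simpa [PureStrategy.pathFlow, hs₀ x, hs x] using h
    · intro y _ hyx
      by_cases hy : g y = 0
      · simp [hy]
      · have hle := hmax y (Finset.mem_filter.2 ⟨Finset.mem_univ _, hy⟩)
        have hn : ¬ (s y).Uses x.edge := fun hu => hyx (hs' y x hu hle).symm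
        simp only [Pi.smul_apply, Pi.sub_apply, PureStrategy.pathFlow, if_neg hn, if_neg (hs₀ x),
          sub_zero, smul_zero]
    · simp
  rw [← finrank_span_eq_card hli, affDim, direction_affineSpan]
  refine Submodule.finrank_mono (Submodule.span_le.2 ?_)
  rintro _ ⟨x, rfl⟩
  exact vsub_mem_vectorSpan ℝ (isUnitFlow_pathFlow hK (s x)) (isUnitFlow_pathFlow hK s₀)

theorem card_innerEdge (hK : 3 ≤ K) :
    (1 / 6 : ℝ) * (N : ℝ) ^ 2 * K ≤ Fintype.card (InnerEdge K N) := by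
  have h1 : Fintype.card (InnerEdge K N) * 2 = (K - 2) * ((N + 1) * N) := by
    have h2 := Finset.sum_range_id_mul_two (N + 1)
    rw [Finset.sum_range_succ', add_zero, Nat.add_sub_cancel] at h2
    simp only [Fintype.card_prod, Fintype.card_fin, Fintype.card_sigma]
    rw [Fin.sum_univ_eq_sum_range fun j => j + 1, mul_assoc, h2]
  have h2 : (Fintype.card (InnerEdge K N) : ℝ) * 2 = ((K : ℝ) - 2) * ((N + 1) * N) := by
    have h3 : ((K - 2 : ℕ) : ℝ) = (K : ℝ) - 2 := by
      rw [Nat.cast_sub (by omega), Nat.cast_ofNat]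
    rw [← h3]
    exact_mod_cast h1
  have h3 : (3 : ℝ) ≤ K := by exact_mod_cast hK
  have h4 : (0 : ℝ) ≤ N := Nat.cast_nonneg N
  -- For `K ≥ 3`, `K - 2 ≥ K / 3`; halving gives the constant `1 / 6`.
  have h5 : (K : ℝ) / 3 * (N * N) ≤ ((K : ℝ) - 2) * ((N + 1) * N) :=
    mul_le_mul (by linarith) (by nlinarith) (by positivity) (by linarith)
  linarith

end Dimension

end Blotto

theorem mainTheorem3 :
    ∃ c : ℝ, 0 < c ∧ ∀ K N : ℕ, 3 ≤ K →
      Blotto.membershipPolytope K N =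
          Blotto.flowOfMixed '' stdSimplex ℝ (Blotto.PureStrategy K N) ∧
        c * (N : ℝ) ^ 2 * (K : ℝ) ≤
          (extensionComplexity (Blotto.membershipPolytope K N) : ℝ) := by
  refine ⟨1 / 6, by norm_num, fun K N hK => ⟨?_, ?_⟩⟩
  · rw [Blotto.membershipPolytope_eq_convexHull (by omega), Blotto.flowOfMixed_image_stdSimplex]
  · refine (Blotto.card_innerEdge hK).trans (Nat.cast_le.2 ?_)
    exact (Blotto.card_innerEdge_le_affDim (by omega)).trans
      (affDim_le_extensionComplexity (Blotto.isPolytope_membershipPolytope (by omega)))
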